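/- For a smooth manifold $N$ (Hausdorff, second countable, without boundary, of finite dimension) let $\mathcal E(N)$ be the algebra of smooth functions $N\to\mathbb R$ with the $C^\infty$ topology, i.e. uniform convergence on compact sets of all derivatives in charts. If a group $\Gamma$ acts on $N$, let $\mathcal E(N)^\Gamma\subseteq\mathcal E(N)$ be the subalgebra of $\Gamma$-invariant functions, with the subspace topology. For a smooth map $\varphi:N\to N'$ write $\varphi^*f=f\circ\varphi$. Theorem. Let $\Gamma$ be a discrete group acting by smooth maps, freely, properly and cocompactly (i.e. $M/\Gamma$ is compact) on a smooth manifold $M$. Let $M/\Gamma$ carry the smooth structure whose charts are local sections of the projection $\pi:M\to M/\Gamma$ followed by charts of $M$. Then: (1) $\mathcal E(M/\Gamma)$ and $\mathcal E(M)^\Gamma$ are Fréchet spaces, and $\pi^*:\mathcal E(M/\Gamma)\to\mathcal E(M)^\Gamma$ is an isomorphism of topological vector spaces. There are $m\in\mathbb N$ and smooth invariants $\sigma_1,\dots,\sigma_m\in\mathcal E(M)^\Gamma$, with $\sigma=(\sigma_1,\dots,\sigma_m):M\to\mathbb R^m$, such that $\sigma=j\circ\pi$ for a smooth embedding $j:M/\Gamma\to\mathbb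 R^m$, and: (2) $\sigma^*\mathcal E(\mathbb R^m)=\mathcal E(M)^\Gamma$; (3) for every smooth manifold $X$ with trivial $\Gamma$-action, $$(\mathrm{id}\times\sigma)^*\mathcal E(X\times\mathbb R^m)=\mathcal E(X\times M)^\Gamma .$$ -/

import Mathlib

open scoped Manifold ContDiff Topology

/-! ### Fréchet spaces -/

/-- A real Fréchet space: a Hausdorff, metrizable, complete, locally convex topological vector
space. Completeness refers to the uniformity of the underlying topological additive group. -/
structure IsFrechetSpace (V : Type*) [AddCommGroup V] [Module ℝ V] [TopologicalSpace V] :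
    Prop where
  isTopologicalAddGroup : IsTopologicalAddGroup V
  continuousSMul : ContinuousSMul ℝ V
  locallyConvexSpace : LocallyConvexSpace ℝ V
  metrizableSpace : TopologicalSpace.MetrizableSpace V
  completeSpace : @CompleteSpace V (IsTopologicalAddGroup.rightUniformSpace V)

/-! ### Pullback of smooth functions -/

section Pullback

variable {E : Type*} [NormedAddCommGroup E] [NormedSpace ℝ E]
  {H : Type*} [TopologicalSpace H] {I : ModelWithCorners ℝ E H}
  {M : Type*} [TopologicalSpace M] [ChartedSpace H M]
  {E' : Type*} [NormedAddCommGroup E'] [NormedSpace ℝ E']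
  {H' : Type*} [TopologicalSpace H'] {J : ModelWithCorners ℝ E' H'}
  {N : Type*} [TopologicalSpace N] [ChartedSpace H' N]

/-- The pullback `φ^* : C^∞(N) → C^∞(M)`, `f ↦ f ∘ φ`, along a smooth map `φ : M → N`, as a
homomorphism of real algebras. -/
noncomputable def smoothPullback (φ : C^∞⟮I, M; J, N⟯) : C^∞⟮J, N; ℝ⟯ →ₐ[ℝ] C^∞⟮I, M; ℝ⟯ where
  toFun f := f.comp φ
  map_one' := rfl
  map_mul' _ _ := rfl
  map_zero' := rfl
  map_add' _ _ := rfl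
  commutes' _ := rfl

variable (I M) in
/-- The algebra `C^∞(M)^Γ` of smooth real functions that are invariant under `Γ`. -/
noncomputable def smoothInvariants (Γ : Type*) [Group Γ] [MulAction Γ M] :
    Subalgebra ℝ C^∞⟮I, M; ℝ⟯ where
  carrier := {f | ∀ (g : Γ) (x : M), f (g • x) = f x}
  mul_mem' {a b} ha hb g x := by
    rw [ContMDiffMap.coe_mul, Pi.mul_apply, Pi.mul_apply, ha, hb]
  add_mem' {a b} ha hb g x := by
    rw [ContMDiffMap.coe_add, Pi.add_apply, Pi.add_apply, ha, hb]
  algebraMap_mem' _ _ _ := rfl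

/-- The smooth map `σ = (σ_1, …, σ_m) : M → ℝ^m` with given smooth components. -/
noncomputable def smoothTuple {m : ℕ} (σ : Fin m → C^∞⟮I, M; ℝ⟯) :
    C^∞⟮I, M; 𝓡 m, EuclideanSpace ℝ (Fin m)⟯ where
  val x := WithLp.toLp 2 (fun i => σ i x)
  property := by
    have h : ContMDiff I 𝓘(ℝ, Fin m → ℝ) ∞ (fun x i => σ i x) :=
      contMDiff_pi_space.2 fun i => (σ i).contMDiff
    exact (EuclideanSpace.equiv (Fin m) ℝ).symm.contDiff.contMDiff.comp h

end Pullback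

/-! ### The topology of `C^∞(M)` -/

section Topology

variable {n : ℕ} {M : Type*} [TopologicalSpace M] [ChartedSpace (EuclideanSpace ℝ (Fin n)) M]

variable (n M) in
/-- The data indexing the seminorms of `C^∞(M)`: a chart of the smooth structure, a compact subset
of its image, and an order of differentiation. -/
structure SeminormIndex where
  chart : OpenPartialHomeomorph M (EuclideanSpace ℝ (Fin n))
  chart_mem : chart ∈ IsManifold.maximalAtlas (𝓡 n) ∞ M
  compactSet : Set (EuclideanSpace ℝ (Fin n))
  isCompact : IsCompact compactSet
  subset_target : compactSet ⊆ chart.target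
  order : ℕ

theorem SeminormIndex.contDiffOn (i : SeminormIndex n M) (f : C^∞⟮𝓡 n, M; ℝ⟯) :
    ContDiffOn ℝ ∞ (f ∘ i.chart.symm) i.chart.target := by
  rw [← contMDiffOn_iff_contDiffOn]
  exact f.contMDiff.comp_contMDiffOn (contMDiffOn_symm_of_mem_maximalAtlas i.chart_mem)

theorem SeminormIndex.contDiffAt (i : SeminormIndex n M) (f : C^∞⟮𝓡 n, M; ℝ⟯)
    (y : i.compactSet) : ContDiffAt ℝ i.order (f ∘ i.chart.symm) y :=
  ((i.contDiffOn f).contDiffAt (i.chart.open_target.mem_nhds (i.subset_target y.2))).of_le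
    (by exact_mod_cast le_top)

theorem SeminormIndex.bddAbove (i : SeminormIndex n M) (f : C^∞⟮𝓡 n, M; ℝ⟯) :
    BddAbove (Set.range fun y : i.compactSet =>
      ‖iteratedFDeriv ℝ i.order (f ∘ i.chart.symm) y‖) := by
  have hc : ContinuousOn (iteratedFDeriv ℝ i.order (f ∘ i.chart.symm)) i.chart.target := by
    have h := (i.contDiffOn f).continuousOn_iteratedFDerivWithin (m := i.order)
      (by exact_mod_cast le_top) i.chart.open_target.uniqueDiffOn
    exact h.congr fun y hy => (iteratedFDerivWithin_of_isOpen i.order i.chart.open_target hy).symm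
  have h := (i.isCompact.image_of_continuousOn (hc.mono i.subset_target).norm).bddAbove
  rwa [Set.image_eq_range] at h

/-- The seminorm `f ↦ sup_{y ∈ K} ‖D^k (f ∘ φ⁻¹)(y)‖` for a chart `φ`, a compact subset `K` of its
image and an order `k`. -/
noncomputable def smoothSeminorm (i : SeminormIndex n M) : Seminorm ℝ C^∞⟮𝓡 n, M; ℝ⟯ :=
  Seminorm.of
    (fun f => ⨆ y : i.compactSet, ‖iteratedFDeriv ℝ i.order (f ∘ i.chart.symm) y‖)
    (fun f g => by
      refine Real.iSup_le (fun y => ?_) (add_nonneg (Real.iSup_nonneg fun _ => norm_nonneg _)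
        (Real.iSup_nonneg fun _ => norm_nonneg _))
      have h : iteratedFDeriv ℝ i.order (⇑(f + g) ∘ i.chart.symm) y
          = iteratedFDeriv ℝ i.order (f ∘ i.chart.symm) y
            + iteratedFDeriv ℝ i.order (g ∘ i.chart.symm) y :=
        iteratedFDeriv_add_apply (i.contDiffAt f y) (i.contDiffAt g y)
      rw [h]
      exact (norm_add_le _ _).trans
        (add_le_add (le_ciSup (i.bddAbove f) y) (le_ciSup (i.bddAbove g) y)))
    (fun a f => by
      rw [← smul_eq_mul, Real.smul_iSup_of_nonneg (norm_nonneg a)]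
      refine iSup_congr fun y => ?_
      have h : iteratedFDeriv ℝ i.order (⇑(a • f) ∘ i.chart.symm) y
          = a • iteratedFDeriv ℝ i.order (f ∘ i.chart.symm) y :=
        iteratedFDeriv_const_smul_apply (i.contDiffAt f y)
      rw [h, norm_smul, smul_eq_mul])

/-- The `C^∞` topology on `C^∞(M)`: locally uniform convergence of all derivatives in charts. -/
noncomputable instance smoothTopology : TopologicalSpace C^∞⟮𝓡 n, M; ℝ⟯ :=
  (SeminormFamily.moduleFilterBasis (𝕜 := ℝ)
    (fun i : SeminormIndex n M => smoothSeminorm i)).topology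

end Topology

/-! ### The quotient manifold -/

section Quotient

/-- The group `Γ` acts on the `n`-manifold `M` by smooth maps. -/
class IsSmoothAction (n : ℕ) (Γ M : Type*) [Group Γ] [MulAction Γ M] [TopologicalSpace M]
    [ChartedSpace (EuclideanSpace ℝ (Fin n)) M] : Prop where
  contMDiff_smul (n Γ M) : ∀ g : Γ, ContMDiff (𝓡 n) (𝓡 n) ∞ (fun x : M => g • x)

theorem isLocalHomeomorph_quotientMk (n : ℕ) (Γ M : Type*) [Group Γ] [MulAction Γ M]
    [TopologicalSpace M] [T2Space M] [ChartedSpace (EuclideanSpace ℝ (Fin n)) M]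
    [IsSmoothAction n Γ M] [ProperlyDiscontinuousSMul Γ M] [IsCancelSMul Γ M] :
    IsLocalHomeomorph (Quotient.mk (MulAction.orbitRel Γ M)) :=
  haveI : ContinuousConstSMul Γ M := ⟨fun g => (IsSmoothAction.contMDiff_smul n Γ M g).continuous⟩
  haveI : LocallyCompactSpace M := ChartedSpace.locallyCompactSpace (EuclideanSpace ℝ (Fin n)) M
  isQuotientCoveringMap_quotientMk_of_properlyDiscontinuousSMul.isCoveringMap.isLocalHomeomorph

variable {n : ℕ} {Γ M : Type*} [Group Γ] [MulAction Γ M] [TopologicalSpace M] [T2Space M]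
  [ChartedSpace (EuclideanSpace ℝ (Fin n)) M] [IsSmoothAction n Γ M]
  [ProperlyDiscontinuousSMul Γ M] [IsCancelSMul Γ M]

/-- The smooth structure of `M/Γ`: its charts are the local sections of `M → M/Γ` followed by
charts of `M`. -/
noncomputable instance quotientChartedSpace :
    ChartedSpace (EuclideanSpace ℝ (Fin n)) (MulAction.orbitRel.Quotient Γ M) :=
  (isLocalHomeomorph_quotientMk n Γ M).chartedSpace Quotient.mk_surjective

/-- A local section of `M → M/Γ` composed with the projection agrees locally with an element
of `Γ`; in particular it is smooth. -/
theorem contMDiffAt_section_comp (p x : M)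
    (hx : Quotient.mk (MulAction.orbitRel Γ M) x ∈
      ((isLocalHomeomorph_quotientMk n Γ M).localInverseAt p).source) :
    ContMDiffAt (𝓡 n) (𝓡 n) ∞ (fun x' : M =>
      (isLocalHomeomorph_quotientMk n Γ M).localInverseAt p
        (Quotient.mk (MulAction.orbitRel Γ M) x')) x := by
  set hπ := isLocalHomeomorph_quotientMk n Γ M
  set s := hπ.localInverseAt p with hs
  have hsymm : ⇑s.symm = Quotient.mk (MulAction.orbitRel Γ M) := hπ.localInverseAt_symm p
  obtain ⟨γ, hγ⟩ : ∃ γ : Γ, γ • x = s (Quotient.mk (MulAction.orbitRel Γ M) x) := by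
    have h := hπ.apply_localInverseAt_of_mem hx
    exact Quotient.exact h
  have hmem : γ • x ∈ s.target := hγ ▸ s.map_source hx
  have hsm := IsSmoothAction.contMDiff_smul n Γ M γ
  refine (hsm x).congr_of_eventuallyEq ?_
  filter_upwards [hsm.continuous.continuousAt.preimage_mem_nhds
    (s.open_target.mem_nhds hmem)] with x' hx'
  have h1 : Quotient.mk (MulAction.orbitRel Γ M) x' = s.symm (γ • x') := by
    rw [hsymm]
    exact (Quotient.sound (show MulAction.orbitRel Γ M (γ • x') x' from ⟨γ, rfl⟩)).symm
  rw [h1, s.right_inv hx']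

theorem exists_eq_of_mem_atlas_quotient
    {e : OpenPartialHomeomorph (MulAction.orbitRel.Quotient Γ M) (EuclideanSpace ℝ (Fin n))}
    (he : e ∈ atlas (EuclideanSpace ℝ (Fin n)) (MulAction.orbitRel.Quotient Γ M)) :
    ∃ p : M, e = ((isLocalHomeomorph_quotientMk n Γ M).localInverseAt p).trans
      (chartAt (EuclideanSpace ℝ (Fin n)) p) := by
  change e ∈ {_e | _} at he
  obtain ⟨q, rfl⟩ := he
  exact ⟨_, rfl⟩

instance quotientIsManifold [IsManifold (𝓡 n) ∞ M] :
    IsManifold (𝓡 n) ∞ (MulAction.orbitRel.Quotient Γ M) := by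
  apply isManifold_of_contDiffOn
  intro e e' he he'
  obtain ⟨p, rfl⟩ := exists_eq_of_mem_atlas_quotient he
  obtain ⟨p', rfl⟩ := exists_eq_of_mem_atlas_quotient he'
  rw [← contMDiffOn_iff_contDiffOn]
  rintro y ⟨hy, -⟩
  have hsymm := (isLocalHomeomorph_quotientMk n Γ M).localInverseAt_symm p
  simp only [mfld_simps, hsymm] at hy
  obtain ⟨⟨hy1, -⟩, hy3, hy4⟩ := hy
  have h1 := contMDiffAt_symm_of_mem_maximalAtlas (I := 𝓡 n) (n := ∞)
    (IsManifold.chart_mem_maximalAtlas p) hy1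
  have h2 := contMDiffAt_section_comp (n := n) p' _ hy3
  have h3 := contMDiffAt_of_mem_maximalAtlas (I := 𝓡 n) (n := ∞)
    (IsManifold.chart_mem_maximalAtlas p') hy4
  have h4 := ContMDiffAt.comp (g := chartAt (EuclideanSpace ℝ (Fin n)) p')
    (f := fun x' : M => (isLocalHomeomorph_quotientMk n Γ M).localInverseAt p'
      (Quotient.mk (MulAction.orbitRel Γ M) x')) _ h3 h2
  refine ContMDiffAt.contMDiffWithinAt ?_
  refine (h4.comp y h1).congr_of_eventuallyEq (.of_forall fun z => ?_)
  simp only [mfld_simps, hsymm]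

/-- The projection `π : M → M/Γ`, as a smooth map. -/
noncomputable def quotientProjection [IsManifold (𝓡 n) ∞ M] :
    C^∞⟮𝓡 n, M; 𝓡 n, MulAction.orbitRel.Quotient Γ M⟯ where
  val := Quotient.mk (MulAction.orbitRel Γ M)
  property := by
    intro x
    obtain ⟨p, hp⟩ := exists_eq_of_mem_atlas_quotient (n := n)
      (chart_mem_atlas (EuclideanSpace ℝ (Fin n)) (Quotient.mk (MulAction.orbitRel Γ M) x))
    have hx := mem_chart_source (EuclideanSpace ℝ (Fin n))
      (Quotient.mk (MulAction.orbitRel Γ M) x)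
    rw [contMDiffAt_iff_target]
    refine ⟨continuous_quotient_mk'.continuousAt, ?_⟩
    rw [hp] at hx
    simp only [extChartAt, hp]
    simp only [mfld_simps] at hx ⊢
    exact ContMDiffAt.comp (g := chartAt (EuclideanSpace ℝ (Fin n)) p)
      (f := fun x' : M => (isLocalHomeomorph_quotientMk n Γ M).localInverseAt p
        (Quotient.mk (MulAction.orbitRel Γ M) x')) x
      (contMDiffAt_of_mem_maximalAtlas (I := 𝓡 n) (n := ∞)
        (IsManifold.chart_mem_maximalAtlas p) hx.2) (contMDiffAt_section_comp (n := n) p x hx.1)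

end Quotient

/-!
The projection `π : M → M/Γ` is smooth and has smooth local sections, so pullback along `π` is a
bijection from `C^∞(M/Γ)` onto the invariant functions (`quotientPullbackEquiv`). All continuity
statements come from one principle (`isBounded_of_eq_comp`): if a linear operator into `C^∞(N)` is
locally given by composition with a smooth map, then the chain rule, together with compactness of
the sets on which the seminorms are taken, bounds each seminorm of the result by finitely many
seminorms of the input, and these may be taken from any covering family of charts and compact sets.
Applied to `π` and to its local sections it shows that `quotientPullbackEquiv` is a homeomorphism;
applied to the identity it shows that a countable family of seminorms defines the topology of
`C^∞(N)` when `N` is `σ`-compact. Completeness is the classical fact that functions whose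
derivatives of all orders converge locally uniformly have a smooth limit
(`contDiffOn_and_tendstoUniformlyOn_of_uniformCauchySeqOn`). Hence `C^∞(M/Γ)` is a Fréchet space
(`isFrechetSpace_smoothFunctions`), and so is the isomorphic space of invariants.

For `σ` take the components of a Whitney embedding `j` of the compact manifold `M/Γ`, composed with
`π`. The inverse function theorem gives smooth local left inverses of `j`
(`Topology.IsEmbedding.exists_smooth_local_leftInverse`); followed by local sections of `π` they are
smooth maps `s` from open sets of `ℝ^m` to `M` with `σ (s z) = z` on the image of `σ`. If `F` is an
invariant function on `X × M`, the functions `(x, z) ↦ F (x, s z)` are local extensions of the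
function induced by `F`, and a partition of unity in `z` glues them, with no condition on the
parameter manifold `X` (`exists_smooth_extension_of_local_lifts`). The case without parameters is
that of a point `X`.
-/

open Filter Set

/-! ### Uniform limits and compositions of smooth functions -/

section Euclidean

variable {E : Type*} [NormedAddCommGroup E] [NormedSpace ℝ E] [LocallyCompactSpace E]
  {ι : Type*} {l : Filter ι} [l.NeBot] {U : Set E} {F : ι → E → ℝ} {g : E → ℝ}

/-- If the derivatives of all orders of smooth functions `F a` are uniformly Cauchy on compact
subsets of the open set `U`, then the pointwise limit `g` is smooth on `U`, and the derivatives
converge to those of `g`, uniformly on compact sets: the limits of the derivatives form a Taylor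
series of `g`. -/
theorem contDiffOn_and_tendstoUniformlyOn_of_uniformCauchySeqOn (hU : IsOpen U)
    (hF : ∀ a, ContDiffOn ℝ ∞ (F a) U)
    (hcau : ∀ (k : ℕ) (K : Set E), K ⊆ U → IsCompact K →
      UniformCauchySeqOn (fun a => iteratedFDeriv ℝ k (F a)) l K)
    (hg : ∀ x ∈ U, Tendsto (fun a => F a x) l (𝓝 (g x))) :
    ContDiffOn ℝ ∞ g U ∧ ∀ (k : ℕ) (K : Set E), K ⊆ U → IsCompact K →
      TendstoUniformlyOn (fun a => iteratedFDeriv ℝ k (F a)) (iteratedFDeriv ℝ k g) l K := by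
  have hlim : ∀ x k, ∃ G : E [×k]→L[ℝ] ℝ, x ∈ U →
      Tendsto (fun a => iteratedFDeriv ℝ k (F a) x) l (𝓝 G) := by
    intro x k
    by_cases hx : x ∈ U
    · obtain ⟨G, hG⟩ := cauchy_map_iff_exists_tendsto.1
        ((hcau k {x} (singleton_subset_iff.2 hx) isCompact_singleton).cauchy_map
          (mem_singleton x))
      exact ⟨G, fun _ => hG⟩
    · exact ⟨0, fun h => absurd h hx⟩
  choose G hG using hlim
  have hunif : ∀ (k : ℕ) (K : Set E), K ⊆ U → IsCompact K →
      TendstoUniformlyOn (fun a => iteratedFDeriv ℝ k (F a)) (fun x => G x k) l K :=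
    fun k K hKU hK => (hcau k K hKU hK).tendstoUniformlyOn_of_tendsto fun x hx => hG x k (hKU hx)
  have hloc : ∀ k : ℕ, TendstoLocallyUniformlyOn (fun a => iteratedFDeriv ℝ k (F a))
      (fun x => G x k) l U :=
    fun k => (tendstoLocallyUniformlyOn_iff_forall_isCompact hU).2 (hunif k)
  have hcd : ∀ a, ∀ x ∈ U, ContDiffAt ℝ ∞ (F a) x := fun a x hx =>
    (hF a).contDiffAt (hU.mem_nhds hx)
  have hdiff : ∀ (k : ℕ) (a : ι), ∀ x ∈ U, HasFDerivAt (iteratedFDeriv ℝ k (F a))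
      (iteratedFDeriv ℝ (k + 1) (F a) x).curryLeft x := by
    intro k a x hx
    have h := ((hcd a x hx).differentiableAt_iteratedFDeriv (m := k)
      (by exact_mod_cast WithTop.coe_lt_top _)).hasFDerivAt
    rwa [show fderiv ℝ (iteratedFDeriv ℝ k (F a)) x
      = (iteratedFDeriv ℝ (k + 1) (F a) x).curryLeft from by
        ext v w; simp [iteratedFDeriv_succ_apply_left]] at h
  have hG' : ∀ k : ℕ, ∀ x ∈ U, HasFDerivAt (fun x => G x k) (G x (k + 1)).curryLeft x := by
    intro k x hx
    refine hasFDerivAt_of_tendstoLocallyUniformlyOn hU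
      (f' := fun a x => (iteratedFDeriv ℝ (k + 1) (F a) x).curryLeft)
      (g' := fun x => (G x (k + 1)).curryLeft) ?_ (hdiff k) (fun x hx => hG x k hx) hx
    exact (continuousMultilinearCurryLeftEquiv ℝ (fun _ : Fin (k + 1) => E)
      ℝ).isometry.uniformContinuous.comp_tendstoLocallyUniformlyOn (hloc (k + 1))
  have htay : HasFTaylorSeriesUpToOn ∞ g G U := by
    refine ⟨fun x hx => ?_, fun k _ x hx => (hG' k x hx).hasFDerivWithinAt,
      fun k _ x hx => (hG' k x hx).continuousAt.continuousWithinAt⟩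
    refine tendsto_nhds_unique ?_ (hg x hx)
    have := ((continuousMultilinearCurryFin0 ℝ E ℝ).continuous.tendsto _).comp (hG x 0 hx)
    exact this
  have heq : ∀ k : ℕ, ∀ x ∈ U, G x k = iteratedFDeriv ℝ k g x := fun k x hx => by
    rw [htay.eq_iteratedFDerivWithin_of_uniqueDiffOn (by exact_mod_cast le_top) hU.uniqueDiffOn hx,
      iteratedFDerivWithin_of_isOpen k hU hx]
  exact ⟨htay.contDiffOn, fun k K hKU hK => (hunif k K hKU hK).congr_right
    fun x hx => heq k x (hKU hx)⟩

variable {E' : Type*} [NormedAddCommGroup E'] [NormedSpace ℝ E'] {E₀ : Type*}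
  [NormedAddCommGroup E₀] [NormedSpace ℝ E₀]

/-- Locally uniform form of the chain rule estimate: near `y`, the `k`-th derivative of `f ∘ h` is
bounded by the derivatives of `f` of order at most `k`, with a constant that does not depend
on `f`. -/
theorem exists_bound_iteratedFDeriv_comp {h : E₀ → E'} {O : Set E₀} {t : Set E'} (hO : IsOpen O)
    (ht : IsOpen t) (hh : ContDiffOn ℝ ∞ h O) (hst : MapsTo h O t) {y : E₀} (hy : y ∈ O) (k : ℕ) :
    ∃ W ∈ 𝓝 y, ∃ C : ℝ, 0 ≤ C ∧ ∀ f : E' → ℝ, ContDiffOn ℝ ∞ f t → ∀ z ∈ W, ∀ B : ℝ,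
      (∀ i ≤ k, ‖iteratedFDeriv ℝ i f (h z)‖ ≤ B) → ‖iteratedFDeriv ℝ k (f ∘ h) z‖ ≤ C * B := by
  have hbd : ∀ i : ℕ, ∀ᶠ z in 𝓝 y,
      ‖iteratedFDerivWithin ℝ i h O z‖ < ‖iteratedFDerivWithin ℝ i h O y‖ + 1 := fun i =>
    ((hh.continuousOn_iteratedFDerivWithin (m := i) (by exact_mod_cast le_top)
      hO.uniqueDiffOn).continuousAt (hO.mem_nhds hy)).norm.eventually_lt
        continuousAt_const (lt_add_one _)
  -- the estimate for compositions asks for bounds `D ^ i`; a common bound `D` works if `1 ≤ D`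
  set D : ℝ := 1 + ∑ i ∈ Finset.range (k + 1), (‖iteratedFDerivWithin ℝ i h O y‖ + 1)
  have hD1 : 1 ≤ D := le_add_of_nonneg_right (Finset.sum_nonneg fun _ _ => by positivity)
  have hDi : ∀ i ≤ k, ‖iteratedFDerivWithin ℝ i h O y‖ + 1 ≤ D := fun i hi =>
    (Finset.single_le_sum (f := fun i => ‖iteratedFDerivWithin ℝ i h O y‖ + 1)
      (fun _ _ => by positivity) (Finset.mem_range.2 (Nat.lt_succ_of_le hi))).trans
        (le_add_of_nonneg_left zero_le_one)
  refine ⟨{z | z ∈ O ∧ ∀ i ∈ Finset.range (k + 1),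
    ‖iteratedFDerivWithin ℝ i h O z‖ < ‖iteratedFDerivWithin ℝ i h O y‖ + 1},
    (hO.eventually_mem hy).and ((Finset.range (k + 1)).eventually_all.2 fun i _ => hbd i),
    k.factorial * D ^ k, by positivity, ?_⟩
  rintro f hf z ⟨hz, hzi⟩ B hB
  rw [← iteratedFDerivWithin_of_isOpen k hO hz, mul_right_comm]
  refine norm_iteratedFDerivWithin_comp_le hf hh (by exact_mod_cast le_top) ht.uniqueDiffOn
    hO.uniqueDiffOn hst hz (fun i hi => ?_) (fun i hi1 hi => ?_)
  · rw [iteratedFDerivWithin_of_isOpen i ht (hst hz)]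
    exact hB i hi
  · exact ((hzi i (Finset.mem_range.2 (Nat.lt_succ_of_le hi))).le.trans (hDi i hi)).trans
      (le_self_pow₀ hD1 (by lia))

end Euclidean

/-! ### The topology of the space of smooth functions -/

section SmoothFunctionTopology

open scoped NNReal

variable {n : ℕ} {N : Type*} [TopologicalSpace N] [ChartedSpace (EuclideanSpace ℝ (Fin n)) N]
  {n' : ℕ} {N' : Type*} [TopologicalSpace N'] [ChartedSpace (EuclideanSpace ℝ (Fin n')) N']
  {V : Type*} [AddCommGroup V] [Module ℝ V] {κ : Type*}

theorem norm_iteratedFDeriv_le_smoothSeminorm (i : SeminormIndex n N) (f : C^∞⟮𝓡 n, N; ℝ⟯)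
    {y : EuclideanSpace ℝ (Fin n)} (hy : y ∈ i.compactSet) :
    ‖iteratedFDeriv ℝ i.order (f ∘ i.chart.symm) y‖ ≤ smoothSeminorm i f :=
  le_ciSup (i.bddAbove f) ⟨y, hy⟩

theorem smoothSeminorm_le (i : SeminormIndex n N) (f : C^∞⟮𝓡 n, N; ℝ⟯) {B : ℝ} (hB : 0 ≤ B)
    (h : ∀ y ∈ i.compactSet, ‖iteratedFDeriv ℝ i.order (f ∘ i.chart.symm) y‖ ≤ B) :
    smoothSeminorm i f ≤ B :=
  Real.iSup_le (fun y => h y y.2) hB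

variable (n N) in
theorem withSeminorms_smoothSeminorm :
    WithSeminorms (fun i : SeminormIndex n N => smoothSeminorm i) :=
  ⟨rfl⟩

/-- The index with the same chart and compact set and with order of differentiation `k`. -/
def SeminormIndex.withOrder (i : SeminormIndex n N) (k : ℕ) : SeminormIndex n N :=
  { i with order := k }

/-- A family of seminorm indices is covering if every point of the manifold lies in the domain of a
chart and is mapped by it into the interior of a compact set such that this chart and this compact
set occur together in the family with every order of differentiation. -/
def IsCoveringFamily (a : κ → SeminormIndex n N) : Prop :=
  ∀ x : N, ∃ i : SeminormIndex n N, x ∈ i.chart.source ∧ i.chart x ∈ interior i.compactSet ∧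
    ∀ k, ∃ c, a c = i.withOrder k

/-- Boundedness of a linear map into `C^∞(N)` may be checked locally on `N`, because the sets over
which the seminorms take suprema are compact. -/
theorem isBounded_of_forall_exists_nhds (q : SeminormFamily ℝ V κ) (T : V →ₗ[ℝ] C^∞⟮𝓡 n, N; ℝ⟯)
    (h : ∀ i : SeminormIndex n N, ∀ y ∈ i.compactSet, ∃ W ∈ 𝓝 y, ∃ (s : Finset κ) (C : ℝ≥0),
      ∀ v, ∀ z ∈ W, ‖iteratedFDeriv ℝ i.order (T v ∘ i.chart.symm) z‖ ≤ (C • s.sup q) v) :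
    Seminorm.IsBounded q (fun i : SeminormIndex n N => smoothSeminorm i) T := by
  classical
  intro i
  obtain ⟨s, C, hsC⟩ : ∃ (s : Finset κ) (C : ℝ≥0), ∀ v, ∀ z ∈ i.compactSet,
      ‖iteratedFDeriv ℝ i.order (T v ∘ i.chart.symm) z‖ ≤ (C • s.sup q) v := by
    refine i.isCompact.induction_on (p := fun K => ∃ (s : Finset κ) (C : ℝ≥0), ∀ v, ∀ z ∈ K,
      ‖iteratedFDeriv ℝ i.order (T v ∘ i.chart.symm) z‖ ≤ (C • s.sup q) v) ?_ ?_ ?_ ?_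
    · exact ⟨∅, 0, fun v z hz => absurd hz (notMem_empty z)⟩
    · rintro K L hKL ⟨s, C, hL⟩
      exact ⟨s, C, fun v z hz => hL v z (hKL hz)⟩
    · rintro K L ⟨s, C, hK⟩ ⟨t, D, hL⟩
      have hle : ∀ {u : Finset κ} {B : ℝ≥0}, u ⊆ s ∪ t → B ≤ max C D → ∀ v,
          (B • u.sup q) v ≤ (max C D • (s ∪ t).sup q) v := fun {u B} hu hB v => by
        have hsup : u.sup q ≤ (s ∪ t).sup q := Finset.sup_mono hu
        exact mul_le_mul (NNReal.coe_le_coe.2 hB) (hsup v) (apply_nonneg _ _) (NNReal.coe_nonneg _)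
      refine ⟨s ∪ t, max C D, fun v z hz => hz.elim (fun hz => ?_) (fun hz => ?_)⟩
      · exact (hK v z hz).trans (hle Finset.subset_union_left (le_max_left _ _) v)
      · exact (hL v z hz).trans (hle Finset.subset_union_right (le_max_right _ _) v)
    · intro y hy
      obtain ⟨W, hW, s, C, hsC⟩ := h i y hy
      exact ⟨W, mem_nhdsWithin_of_mem_nhds hW, s, C, hsC⟩
  exact ⟨s, C, fun v => smoothSeminorm_le i (T v) (apply_nonneg _ _) (hsC v)⟩

/-- If `T v` is locally of the form `S v ∘ s` with a smooth map `s` independent of `v`, then the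
seminorms of `T v` are bounded by those of `S v`, by the chain rule; a covering family of seminorms
of `S v` suffices. -/
theorem isBounded_of_eq_comp (a : κ → SeminormIndex n' N') (ha : IsCoveringFamily a)
    (T : V →ₗ[ℝ] C^∞⟮𝓡 n, N; ℝ⟯) (S : V →ₗ[ℝ] C^∞⟮𝓡 n', N'; ℝ⟯)
    (h : ∀ x : N, ∃ U : Set N, IsOpen U ∧ x ∈ U ∧ ∃ s : N → N', ContMDiffOn (𝓡 n) (𝓡 n') ∞ s U ∧
      ∀ v, ∀ x' ∈ U, T v x' = S v (s x')) :
    Seminorm.IsBounded (fun c => (smoothSeminorm (a c)).comp S)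
      (fun i : SeminormIndex n N => smoothSeminorm i) T := by
  classical
  refine isBounded_of_forall_exists_nhds _ T fun i y hy => ?_
  obtain ⟨U, hU, hyU, s, hs, hTS⟩ := h (i.chart.symm y)
  obtain ⟨i', hi's, hi'K, hi'c⟩ := ha (s (i.chart.symm y))
  choose c hc using hi'c
  have hysymm := contMDiffOn_symm_of_mem_maximalAtlas i.chart_mem
  have h1 : ContMDiffOn (𝓡 n) (𝓡 n') ∞ (s ∘ i.chart.symm)
      (i.chart.target ∩ i.chart.symm ⁻¹' U) :=
    hs.comp (hysymm.mono inter_subset_left) fun z hz => hz.2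
  have ho1 : IsOpen (i.chart.target ∩ i.chart.symm ⁻¹' U) :=
    i.chart.symm.isOpen_inter_preimage hU
  set O₂ := (i.chart.target ∩ i.chart.symm ⁻¹' U) ∩ (s ∘ i.chart.symm) ⁻¹' i'.chart.source
  have ho2 : IsOpen O₂ := h1.continuousOn.isOpen_inter_preimage ho1 i'.chart.open_source
  have h2 : ContMDiffOn (𝓡 n) (𝓡 n') ∞ (i'.chart ∘ s ∘ i.chart.symm) O₂ :=
    (contMDiffOn_of_mem_maximalAtlas i'.chart_mem).comp (h1.mono inter_subset_left)
      fun z hz => hz.2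
  set O := O₂ ∩ (i'.chart ∘ s ∘ i.chart.symm) ⁻¹' interior i'.compactSet
  have ho : IsOpen O := h2.continuousOn.isOpen_inter_preimage ho2 isOpen_interior
  have hyO : y ∈ O := ⟨⟨⟨i.subset_target hy, hyU⟩, hi's⟩, hi'K⟩
  obtain ⟨W, hW, C, hC, hWC⟩ := exists_bound_iteratedFDeriv_comp
    (h := i'.chart ∘ s ∘ i.chart.symm) (t := i'.chart.target) ho i'.chart.open_target
    (contMDiffOn_iff_contDiffOn.1 (h2.mono inter_subset_left))
    (fun z hz => i'.chart.map_source hz.1.2) hyO i.order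
  refine ⟨W ∩ O, inter_mem hW (ho.mem_nhds hyO), (Finset.range (i.order + 1)).image c, ⟨C, hC⟩,
    fun v z hz => ?_⟩
  have heq : iteratedFDeriv ℝ i.order (T v ∘ i.chart.symm) z
      = iteratedFDeriv ℝ i.order ((S v ∘ i'.chart.symm) ∘ i'.chart ∘ s ∘ i.chart.symm) z := by
    refine EventuallyEq.eq_of_nhds (EventuallyEq.iteratedFDeriv ℝ ?_ _)
    filter_upwards [ho.mem_nhds hz.2] with w hw
    have hws : s (i.chart.symm w) ∈ i'.chart.source := hw.1.2
    simp only [Function.comp_apply]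
    rw [i'.chart.left_inv hws, hTS v _ hw.1.1.2]
  rw [heq]
  refine hWC _ (i'.contDiffOn (S v)) z hz.1 _ fun l hl => ?_
  have hK : (i'.chart ∘ s ∘ i.chart.symm) z ∈ i'.compactSet := interior_subset hz.2.2
  refine (norm_iteratedFDeriv_le_smoothSeminorm (i'.withOrder l) (S v) hK).trans ?_
  have hle := Seminorm.le_finset_sup_apply
    (p := fun c => (smoothSeminorm (a c)).comp S) (x := v)
    (Finset.mem_image_of_mem c (Finset.mem_range.2 (Nat.lt_succ_of_le hl)))
  rwa [Seminorm.comp_apply, hc l] at hle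

variable (n N) in
theorem exists_seminormIndex_mem_interior [IsManifold (𝓡 n) ∞ N] (x : N) :
    ∃ i : SeminormIndex n N, x ∈ i.chart.source ∧ i.chart x ∈ interior i.compactSet := by
  obtain ⟨K, hK, hxK, hKt⟩ := exists_compact_subset
    (chartAt (EuclideanSpace ℝ (Fin n)) x).open_target (mem_chart_target _ x)
  exact ⟨⟨chartAt _ x, IsManifold.chart_mem_maximalAtlas x, K, hK, hKt, 0⟩,
    mem_chart_source _ x, hxK⟩

variable (n N) in
theorem isCoveringFamily_id [IsManifold (𝓡 n) ∞ N] :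
    IsCoveringFamily (fun i : SeminormIndex n N => i) := fun x => by
  obtain ⟨i, hi⟩ := exists_seminormIndex_mem_interior n N x
  exact ⟨i, hi.1, hi.2, fun k => ⟨_, rfl⟩⟩

variable (n N) in
theorem exists_countable_isCoveringFamily [IsManifold (𝓡 n) ∞ N] [SigmaCompactSpace N] :
    ∃ S : Set N, S.Countable ∧ ∃ a : S × ℕ → SeminormIndex n N, IsCoveringFamily a := by
  choose i hi hi' using exists_seminormIndex_mem_interior n N
  obtain ⟨S, hS, hcov⟩ := countable_cover_nhds_of_sigmaCompact
    (f := fun x => (i x).chart.source ∩ (i x).chart ⁻¹' interior (i x).compactSet) fun x =>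
      ((i x).chart.isOpen_inter_preimage isOpen_interior).mem_nhds ⟨hi x, hi' x⟩
  refine ⟨S, hS, fun c => (i c.1).withOrder c.2, fun x => ?_⟩
  obtain ⟨y, hyS, hxy⟩ := mem_iUnion₂.1 (hcov.ge (mem_univ x))
  exact ⟨i y, hxy.1, hxy.2, fun k => ⟨(⟨y, hyS⟩, k), rfl⟩⟩

/-- A covering family of seminorms already defines the topology of `C^∞(N)`. -/
theorem IsCoveringFamily.withSeminorms {a : κ → SeminormIndex n N} (ha : IsCoveringFamily a) :
    WithSeminorms (fun c => smoothSeminorm (a c)) := by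
  refine (withSeminorms_smoothSeminorm n N).congr (fun c => ⟨{a c}, 1, ?_⟩) ?_
  · rw [Finset.sup_singleton, one_smul]; rfl
  · exact isBounded_of_eq_comp a ha LinearMap.id LinearMap.id fun x =>
      ⟨univ, isOpen_univ, mem_univ x, id, contMDiffOn_id, fun _ _ _ => rfl⟩

theorem iteratedFDeriv_smoothFunctions_sub (i : SeminormIndex n N) (f g : C^∞⟮𝓡 n, N; ℝ⟯)
    {y : EuclideanSpace ℝ (Fin n)} (hy : y ∈ i.compactSet) :
    iteratedFDeriv ℝ i.order (⇑(f - g) ∘ i.chart.symm) y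
      = iteratedFDeriv ℝ i.order (f ∘ i.chart.symm) y
        - iteratedFDeriv ℝ i.order (g ∘ i.chart.symm) y :=
  iteratedFDeriv_sub_apply (i.contDiffAt f ⟨y, hy⟩) (i.contDiffAt g ⟨y, hy⟩)

theorem norm_apply_le_smoothSeminorm_withOrder_zero (i : SeminormIndex n N) (f : C^∞⟮𝓡 n, N; ℝ⟯)
    {x : N} (hx : x ∈ i.chart.source) (hxK : i.chart x ∈ i.compactSet) :
    ‖f x‖ ≤ smoothSeminorm (i.withOrder 0) f := by
  have h := norm_iteratedFDeriv_le_smoothSeminorm (i.withOrder 0) f hxK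
  change ‖iteratedFDeriv ℝ 0 (f ∘ i.chart.symm) _‖ ≤ _ at h
  rwa [norm_iteratedFDeriv_zero, Function.comp_apply, i.chart.left_inv hx] at h

variable (n N) in
theorem t2Space_smoothFunctions [IsManifold (𝓡 n) ∞ N] : T2Space C^∞⟮𝓡 n, N; ℝ⟯ := by
  have hp := withSeminorms_smoothSeminorm n N
  have := hp.topologicalAddGroup
  have := hp.T1_of_separating fun f hf => by
    obtain ⟨x, hx⟩ : ∃ x, f x ≠ 0 := by
      by_contra! h
      exact hf (ContMDiffMap.ext h)
    obtain ⟨i, hi, hi'⟩ := exists_seminormIndex_mem_interior n N x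
    refine ⟨i.withOrder 0, fun h0 => hx (norm_le_zero_iff.1 ?_)⟩
    exact (norm_apply_le_smoothSeminorm_withOrder_zero i f hi (interior_subset hi')).trans_eq h0
  infer_instance

variable (n N) in
/-- Completeness of `C^∞(N)`: in charts all derivatives along a Cauchy filter converge locally
uniformly, so the pointwise limit is smooth and is the limit in `C^∞(N)`. -/
theorem completeSpace_smoothFunctions [IsManifold (𝓡 n) ∞ N] :
    @CompleteSpace C^∞⟮𝓡 n, N; ℝ⟯ (@IsTopologicalAddGroup.rightUniformSpace _ _ _
      (withSeminorms_smoothSeminorm n N).topologicalAddGroup) := by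
  have hp := withSeminorms_smoothSeminorm n N
  have := hp.topologicalAddGroup
  let _ : UniformSpace C^∞⟮𝓡 n, N; ℝ⟯ := IsTopologicalAddGroup.rightUniformSpace _
  have : IsUniformAddGroup C^∞⟮𝓡 n, N; ℝ⟯ := isUniformAddGroup_of_addCommGroup
  refine ⟨fun {l} hl => ?_⟩
  have := hl.1
  -- the Cauchy condition, one seminorm at a time
  have hcau : ∀ (i : SeminormIndex n N) (ε : ℝ), 0 < ε →
      ∀ᶠ p in l ×ˢ l, smoothSeminorm i (p.2 - p.1) < ε := fun i ε hε => by
    have h := hl.2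
    rw [uniformity_eq_comap_nhds_zero, ← tendsto_iff_comap] at h
    simpa using (hp.tendsto_nhds _ _).1 h i ε hε
  have hunif : ∀ (e : OpenPartialHomeomorph N (EuclideanSpace ℝ (Fin n))),
      e ∈ IsManifold.maximalAtlas (𝓡 n) ∞ N → ∀ (k : ℕ) (K : Set (EuclideanSpace ℝ (Fin n))),
      K ⊆ e.target → IsCompact K → UniformCauchySeqOn
        (fun f : C^∞⟮𝓡 n, N; ℝ⟯ => iteratedFDeriv ℝ k (f ∘ e.symm)) l K := by
    intro e he k K hKe hK u hu
    obtain ⟨ε, hε, hεu⟩ := Metric.mem_uniformity_dist.1 hu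
    filter_upwards [hcau ⟨e, he, K, hK, hKe, k⟩ ε hε] with p hp x hx
    refine hεu ?_
    rw [dist_comm, dist_eq_norm, ← iteratedFDeriv_smoothFunctions_sub ⟨e, he, K, hK, hKe, k⟩ _ _ hx]
    exact (norm_iteratedFDeriv_le_smoothSeminorm ⟨e, he, K, hK, hKe, k⟩ _ hx).trans_lt hp
  have hlim : ∀ x : N, ∃ y : ℝ, Tendsto (fun f : C^∞⟮𝓡 n, N; ℝ⟯ => f x) l (𝓝 y) := by
    intro x
    refine cauchy_map_iff_exists_tendsto.1 (cauchy_map_iff.2 ⟨inferInstance, ?_⟩)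
    obtain ⟨i, hi, hi'⟩ := exists_seminormIndex_mem_interior n N x
    refine Metric.uniformity_basis_dist.tendsto_right_iff.2 fun ε hε => ?_
    filter_upwards [hcau (i.withOrder 0) ε hε] with p hp
    rw [dist_comm, Real.dist_eq]
    exact (norm_apply_le_smoothSeminorm_withOrder_zero i (p.2 - p.1) hi
      (interior_subset hi')).trans_lt hp
  choose g hg using hlim
  have key := fun e he => contDiffOn_and_tendstoUniformlyOn_of_uniformCauchySeqOn
    (g := g ∘ e.symm) e.open_target
    (fun f : C^∞⟮𝓡 n, N; ℝ⟯ => (SeminormIndex.contDiffOn ⟨e, he, ∅, isCompact_empty,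
      empty_subset _, 0⟩ f)) (hunif e he) (fun y _ => hg _)
  have hgs : ContMDiff (𝓡 n) 𝓘(ℝ) ∞ g := by
    intro x
    have he := IsManifold.chart_mem_maximalAtlas (I := 𝓡 n) (n := ∞) x
    have hx := mem_chart_source (EuclideanSpace ℝ (Fin n)) x
    have h1 := (contMDiffOn_iff_contDiffOn.2 (key _ he).1).comp
      (contMDiffOn_of_mem_maximalAtlas he) fun z hz => (chartAt _ x).map_source hz
    refine (h1.congr fun z hz => ?_).contMDiffAt ((chartAt _ x).open_source.mem_nhds hx)
    simp [(chartAt (EuclideanSpace ℝ (Fin n)) x).left_inv hz]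
  obtain ⟨G, rfl⟩ : ∃ G : C^∞⟮𝓡 n, N; ℝ⟯, ⇑G = g := ⟨⟨g, hgs⟩, rfl⟩
  refine ⟨G, (hp.tendsto_nhds (fun f => f) G).2 fun i ε hε => ?_⟩
  have h := (key i.chart i.chart_mem).2 i.order i.compactSet i.subset_target i.isCompact
  filter_upwards [Metric.tendstoUniformlyOn_iff.1 h (ε / 2) (half_pos hε)] with f hf
  refine (smoothSeminorm_le i _ (half_pos hε).le fun y hy => ?_).trans_lt (half_lt_self hε)
  rw [iteratedFDeriv_smoothFunctions_sub i _ _ hy, ← dist_eq_norm, dist_comm]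
  exact (hf y hy).le

variable (n N) in
/-- For a `σ`-compact manifold `N` the space `C^∞(N)` is a Fréchet space: a countable atlas gives
countably many defining seminorms. -/
theorem isFrechetSpace_smoothFunctions [IsManifold (𝓡 n) ∞ N] [SigmaCompactSpace N] :
    IsFrechetSpace C^∞⟮𝓡 n, N; ℝ⟯ where
  isTopologicalAddGroup := (withSeminorms_smoothSeminorm n N).topologicalAddGroup
  continuousSMul := (withSeminorms_smoothSeminorm n N).continuousSMul
  locallyConvexSpace := (withSeminorms_smoothSeminorm n N).toLocallyConvexSpace
  metrizableSpace := by
    obtain ⟨S, hS, a, ha⟩ := exists_countable_isCoveringFamily n N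
    have := hS.to_subtype
    have := ha.withSeminorms.firstCountableTopology
    have := (withSeminorms_smoothSeminorm n N).topologicalAddGroup
    have := t2Space_smoothFunctions n N
    let _ : UniformSpace C^∞⟮𝓡 n, N; ℝ⟯ := IsTopologicalAddGroup.rightUniformSpace _
    have : IsUniformAddGroup C^∞⟮𝓡 n, N; ℝ⟯ := isUniformAddGroup_of_addCommGroup
    have : (uniformity C^∞⟮𝓡 n, N; ℝ⟯).IsCountablyGenerated :=
      IsUniformAddGroup.uniformity_countably_generated
    exact UniformSpace.metrizableSpace
  completeSpace := completeSpace_smoothFunctions n N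

variable (n N) in
theorem withSeminorms_smoothInvariants (Γ : Type*) [Group Γ] [MulAction Γ N] :
    WithSeminorms (fun i : SeminormIndex n N =>
      (smoothSeminorm i).comp (smoothInvariants (𝓡 n) N Γ).val.toLinearMap) :=
  Topology.IsInducing.withSeminorms (withSeminorms_smoothSeminorm n N)
    (f := (smoothInvariants (𝓡 n) N Γ).val.toLinearMap) Topology.IsInducing.subtypeVal

theorem IsFrechetSpace.of_continuousLinearEquiv {V W : Type*} [AddCommGroup V] [Module ℝ V]
    [TopologicalSpace V] [AddCommGroup W] [Module ℝ W] [TopologicalSpace W]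
    (hV : IsFrechetSpace V) [hW : IsTopologicalAddGroup W] [hW' : ContinuousSMul ℝ W]
    (e : V ≃L[ℝ] W) : IsFrechetSpace W where
  isTopologicalAddGroup := hW
  continuousSMul := hW'
  locallyConvexSpace := by
    have := hV.isTopologicalAddGroup
    have := hV.continuousSMul
    have := hV.locallyConvexSpace
    have h := LocallyConvexSpace.induced (𝕜 := ℝ) (F := V) e.symm.toLinearEquiv.toLinearMap
    rwa [show TopologicalSpace.induced _ _ = ‹TopologicalSpace W› from
      e.symm.toHomeomorph.isInducing.eq_induced.symm] at h
  metrizableSpace := by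
    have := hV.metrizableSpace
    exact e.symm.toHomeomorph.isEmbedding.metrizableSpace
  completeSpace := by
    have := hV.isTopologicalAddGroup
    let _ : UniformSpace V := IsTopologicalAddGroup.rightUniformSpace V
    let _ : UniformSpace W := IsTopologicalAddGroup.rightUniformSpace W
    have : IsUniformAddGroup V := isUniformAddGroup_of_addCommGroup
    have : IsUniformAddGroup W := isUniformAddGroup_of_addCommGroup
    have := hV.completeSpace
    exact (e.isUniformEmbedding.isUniformInducing.completeSpace_congr e.surjective).1 this

end SmoothFunctionTopology

/-! ### Smooth functions on the quotient -/

section QuotientManifold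

variable {n : ℕ} {Γ M : Type*} [Group Γ] [MulAction Γ M] [TopologicalSpace M] [T2Space M]
  [ChartedSpace (EuclideanSpace ℝ (Fin n)) M] [IsSmoothAction n Γ M]
  [ProperlyDiscontinuousSMul Γ M] [IsCancelSMul Γ M] [IsManifold (𝓡 n) ∞ M]

variable (n) in
/-- The local sections of `M → M/Γ` are smooth for the smooth structure of the quotient. -/
theorem contMDiffOn_localInverseAt_quotientMk (p : M) :
    ContMDiffOn (𝓡 n) (𝓡 n) ∞ ((isLocalHomeomorph_quotientMk n Γ M).localInverseAt p)
      ((isLocalHomeomorph_quotientMk n Γ M).localInverseAt p).source := by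
  set hπ := isLocalHomeomorph_quotientMk n Γ M
  intro q hq
  obtain ⟨p', hp'⟩ := exists_eq_of_mem_atlas_quotient (n := n) (Γ := Γ) (M := M)
    (chart_mem_atlas (EuclideanSpace ℝ (Fin n)) q)
  have hqc := mem_chart_source (EuclideanSpace ℝ (Fin n)) q
  have hqc' : q ∈ (hπ.localInverseAt p').source ∧
      hπ.localInverseAt p' q ∈ (chartAt (EuclideanSpace ℝ (Fin n)) p').source := by
    rw [hp'] at hqc
    simpa only [mfld_simps] using hqc
  -- near `q` the section through `p'` is the chart at `q` followed by an inverse chart of `M`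
  have h1 : ContMDiffAt (𝓡 n) (𝓡 n) ∞ (hπ.localInverseAt p') q := by
    have hc := contMDiffAt_of_mem_maximalAtlas (I := 𝓡 n) (n := ∞)
      (IsManifold.chart_mem_maximalAtlas q) hqc
    have hs := contMDiffAt_symm_of_mem_maximalAtlas (I := 𝓡 n) (n := ∞)
      (IsManifold.chart_mem_maximalAtlas p')
      (x := chartAt (EuclideanSpace ℝ (Fin n)) q q)
      (by rw [hp']; exact (chartAt (EuclideanSpace ℝ (Fin n)) p').map_source hqc'.2)
    refine (hs.comp q hc).congr_of_eventuallyEq ?_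
    filter_upwards [(chartAt (EuclideanSpace ℝ (Fin n)) q).open_source.mem_nhds hqc] with z hz
    rw [hp'] at hz ⊢
    simp only [mfld_simps] at hz ⊢
    exact ((chartAt (EuclideanSpace ℝ (Fin n)) p').left_inv hz.2).symm
  have hmk := hπ.apply_localInverseAt_of_mem hqc'.1
  have h2 := contMDiffAt_section_comp (n := n) (Γ := Γ) p (hπ.localInverseAt p' q)
    (by rw [hmk]; exact hq)
  refine ((h2.comp q h1).congr_of_eventuallyEq ?_).contMDiffWithinAt
  filter_upwards [(hπ.localInverseAt p').open_source.mem_nhds hqc'.1] with z hz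
  simp only [Function.comp_apply]
  rw [hπ.apply_localInverseAt_of_mem hz]

/-- The projection `M → M/Γ` has a smooth section near every point. -/
theorem exists_smooth_local_section (q : MulAction.orbitRel.Quotient Γ M) :
    ∃ U : Set (MulAction.orbitRel.Quotient Γ M), IsOpen U ∧ q ∈ U ∧
      ∃ s : MulAction.orbitRel.Quotient Γ M → M, ContMDiffOn (𝓡 n) (𝓡 n) ∞ s U ∧
        ∀ q' ∈ U, quotientProjection (n := n) (s q') = q' := by
  obtain ⟨p, rfl⟩ := Quotient.mk_surjective q
  have hπ := isLocalHomeomorph_quotientMk n Γ M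
  exact ⟨(hπ.localInverseAt p).source, (hπ.localInverseAt p).open_source,
    hπ.apply_self_mem_localInverseAt_source, hπ.localInverseAt p,
    contMDiffOn_localInverseAt_quotientMk n p, fun q' hq' => hπ.apply_localInverseAt_of_mem hq'⟩

theorem quotientProjection_surjective :
    Function.Surjective (quotientProjection (n := n) (Γ := Γ) (M := M)) :=
  Quotient.mk_surjective

theorem quotientProjection_eq_iff {x y : M} :
    quotientProjection (n := n) (Γ := Γ) x = quotientProjection (n := n) (Γ := Γ) y ↔
      ∃ g : Γ, g • y = x :=
  Quotient.eq

theorem quotientProjection_smul (g : Γ) (x : M) :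
    quotientProjection (n := n) (Γ := Γ) (g • x) = quotientProjection (n := n) (Γ := Γ) x :=
  quotientProjection_eq_iff.2 ⟨g, rfl⟩

/-- An invariant smooth function descends to a smooth function on the quotient. -/
theorem exists_comp_quotientProjection_eq {f : C^∞⟮𝓡 n, M; ℝ⟯}
    (hf : f ∈ smoothInvariants (𝓡 n) M Γ) :
    ∃ F : C^∞⟮𝓡 n, MulAction.orbitRel.Quotient Γ M; ℝ⟯,
      ∀ x, F (quotientProjection (n := n) (Γ := Γ) x) = f x := by
  have hlift : ∀ x y : M, MulAction.orbitRel Γ M x y → f x = f y := by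
    rintro x y ⟨g, rfl⟩
    exact hf g y
  refine ⟨⟨Quotient.lift f hlift, fun q => ?_⟩, fun x => rfl⟩
  obtain ⟨U, hU, hqU, s, hs, hsU⟩ := exists_smooth_local_section (n := n) q
  refine ((f.contMDiff.comp_contMDiffOn hs).congr fun q' hq' => ?_).contMDiffAt (hU.mem_nhds hqU)
  conv_lhs => rw [← hsU q' hq']
  rfl

variable (n Γ M) in
/-- The pullback of smooth functions along `M → M/Γ`, as a linear isomorphism onto the invariant
smooth functions. -/
noncomputable def quotientPullbackEquiv :
    C^∞⟮𝓡 n, MulAction.orbitRel.Quotient Γ M; ℝ⟯ ≃ₗ[ℝ] smoothInvariants (𝓡 n) M Γ :=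
  LinearEquiv.ofBijective
    ((smoothPullback quotientProjection).toLinearMap.codRestrict
      (Subalgebra.toSubmodule (smoothInvariants (𝓡 n) M Γ))
      fun F g x => congrArg F (quotientProjection_smul g x))
    ⟨fun F G h => ContMDiffMap.ext fun q => by
      obtain ⟨x, rfl⟩ := quotientProjection_surjective (n := n) q
      exact DFunLike.congr_fun (congrArg Subtype.val h) x,
    fun f => by
      obtain ⟨F, hF⟩ := exists_comp_quotientProjection_eq f.2
      exact ⟨F, Subtype.ext (ContMDiffMap.ext hF)⟩⟩

variable (n Γ M) in
/-- The pullback along `M → M/Γ` as an isomorphism of topological vector spaces. Both directions are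
continuous by the chain rule: the projection and its local sections are smooth. -/
noncomputable def quotientPullbackContinuousEquiv :
    C^∞⟮𝓡 n, MulAction.orbitRel.Quotient Γ M; ℝ⟯ ≃L[ℝ] smoothInvariants (𝓡 n) M Γ where
  toLinearEquiv := quotientPullbackEquiv n Γ M
  continuous_toFun := by
    refine Topology.IsInducing.subtypeVal.continuous_iff.2 ?_
    refine WithSeminorms.continuous_of_isBounded
      (withSeminorms_smoothSeminorm n (MulAction.orbitRel.Quotient Γ M))
      (withSeminorms_smoothSeminorm n M) (smoothPullback quotientProjection).toLinearMap
      (isBounded_of_eq_comp _ (isCoveringFamily_id n _) _ LinearMap.id fun x => ?_)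
    exact ⟨univ, isOpen_univ, mem_univ x, quotientProjection,
      quotientProjection.contMDiff.contMDiffOn, fun _ _ _ => rfl⟩
  continuous_invFun := by
    refine WithSeminorms.continuous_of_isBounded (withSeminorms_smoothInvariants n M Γ)
      (withSeminorms_smoothSeminorm n (MulAction.orbitRel.Quotient Γ M))
      (quotientPullbackEquiv n Γ M).symm.toLinearMap
      (isBounded_of_eq_comp _ (isCoveringFamily_id n M) _
        (smoothInvariants (𝓡 n) M Γ).val.toLinearMap fun q => ?_)
    obtain ⟨U, hU, hqU, s, hs, hsU⟩ := exists_smooth_local_section (n := n) q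
    refine ⟨U, hU, hqU, s, hs, fun f q' hq' => ?_⟩
    obtain ⟨F, rfl⟩ := (quotientPullbackEquiv n Γ M).surjective f
    change (quotientPullbackEquiv n Γ M).symm (quotientPullbackEquiv n Γ M F) q'
      = F (quotientProjection (s q'))
    rw [hsU q' hq', LinearEquiv.symm_apply_apply]

end QuotientManifold

/-! ### Extension of smooth functions from an embedded manifold -/

section Extension

/-- A smooth embedding with injective differential has, near each point of its image, a smooth
left inverse defined on an open subset of the ambient space. -/
theorem Topology.IsEmbedding.exists_smooth_local_leftInverse {n m : ℕ} {N : Type*}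
    [TopologicalSpace N] [ChartedSpace (EuclideanSpace ℝ (Fin n)) N] [IsManifold (𝓡 n) ∞ N]
    {j : N → EuclideanSpace ℝ (Fin m)} (hj : Topology.IsEmbedding j)
    (hjs : ContMDiff (𝓡 n) (𝓡 m) ∞ j) {q : N}
    (hq : Function.Injective (mfderiv (𝓡 n) (𝓡 m) j q)) :
    ∃ V : Set (EuclideanSpace ℝ (Fin m)), IsOpen V ∧ j q ∈ V ∧
      ∃ r : EuclideanSpace ℝ (Fin m) → N, ContMDiffOn (𝓡 m) (𝓡 n) ∞ r V ∧
        ∀ q', j q' ∈ V → r (j q') = q' := by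
  set φ := chartAt (EuclideanSpace ℝ (Fin n)) q
  have hφ := IsManifold.chart_mem_maximalAtlas (I := 𝓡 n) (n := ∞) q
  have hqs : q ∈ φ.source := mem_chart_source _ q
  have hqt : φ q ∈ φ.target := φ.map_source hqs
  have hh : ContDiffOn ℝ ∞ (j ∘ φ.symm) φ.target :=
    contMDiffOn_iff_contDiffOn.1
      (hjs.comp_contMDiffOn (contMDiffOn_symm_of_mem_maximalAtlas hφ))
  have hhd : ∀ y ∈ φ.target, ContDiffAt ℝ ∞ (j ∘ φ.symm) y := fun y hy =>
    hh.contDiffAt (φ.open_target.mem_nhds hy)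
  have hinj : Function.Injective (fderiv ℝ (j ∘ φ.symm) (φ q)) := by
    have hd : MDifferentiableAt (𝓡 n) (𝓡 m) j q := (hjs q).mdifferentiableAt (by simp)
    have : mfderiv (𝓡 n) (𝓡 m) j q = fderiv ℝ (j ∘ φ.symm) (φ q) := by
      simp [mfderiv, hd, writtenInExtChartAt, φ]
      rfl
    rwa [this] at hq
  -- composing with a linear left inverse of the differential reduces to the inverse function
  -- theorem in dimension `n`
  obtain ⟨P₀, hP₀⟩ := LinearMap.exists_leftInverse_of_injective
    (fderiv ℝ (j ∘ φ.symm) (φ q)).toLinearMap (LinearMap.ker_eq_bot.2 hinj)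
  set P := LinearMap.toContinuousLinearMap P₀
  set k := P ∘ j ∘ φ.symm
  have hk : ∀ y ∈ φ.target, ContDiffAt ℝ ∞ k y := fun y hy =>
    P.contDiff.contDiffAt.comp y (hhd y hy)
  have hk' : HasFDerivAt k
      (ContinuousLinearEquiv.refl ℝ (EuclideanSpace ℝ (Fin n)) : _ →L[ℝ] _) (φ q) := by
    have h := P.hasFDerivAt.comp (φ q) ((hhd _ hqt).differentiableAt (by simp)).hasFDerivAt
    have hPd : P ∘L fderiv ℝ (j ∘ φ.symm) (φ q) = ContinuousLinearMap.id ℝ _ :=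
      ContinuousLinearMap.ext fun v => LinearMap.congr_fun hP₀ v
    rwa [hPd] at h
  set e := (hk _ hqt).toOpenPartialHomeomorph k hk' (by simp)
  have hek : ⇑e = k := rfl
  have hqe : φ q ∈ e.source := (hk _ hqt).mem_toOpenPartialHomeomorph_source hk' (by simp)
  have hev : ∀ᶠ y in 𝓝 (φ q), (y ∈ φ.target ∧ y ∈ e.source) ∧ fderiv ℝ k y ∈
      range ((↑) : (EuclideanSpace ℝ (Fin n) ≃L[ℝ] EuclideanSpace ℝ (Fin n)) → _) := by
    refine ((φ.open_target.eventually_mem hqt).and (e.open_source.eventually_mem hqe)).and ?_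
    have hc : ContinuousAt (fderiv ℝ k) (φ q) :=
      ((hk _ hqt).fderiv_right (m := 0) (by simp)).continuousAt
    have := ContinuousLinearEquiv.nhds (ContinuousLinearEquiv.refl ℝ (EuclideanSpace ℝ (Fin n)))
    exact hc (by rw [hk'.fderiv]; exact this)
  obtain ⟨O, hOsub, hO, hqO⟩ := eventually_nhds_iff.1 hev
  have hρ : ContDiffOn ℝ ∞ e.symm (e.target ∩ e.symm ⁻¹' O) := by
    rintro z ⟨hz, hzO⟩
    obtain ⟨⟨hzt, -⟩, f', hf'⟩ := hOsub _ hzO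
    refine (e.contDiffAt_symm (f₀' := f') hz ?_ (hk _ hzt)).contDiffWithinAt
    rw [hf']
    exact ((hk _ hzt).differentiableAt (by simp)).hasFDerivAt
  obtain ⟨V₁, hV₁, hV₁'⟩ := hj.isOpen_iff.1 (φ.isOpen_inter_preimage hO)
  have hV₁'' : ∀ q', j q' ∈ V₁ → q' ∈ φ.source ∧ φ q' ∈ O := fun q' hq' => hV₁'.le hq'
  have hkey : ∀ q', j q' ∈ V₁ → P (j q') = e (φ q') := fun q' hq' => by
    simp [hek, k, φ.left_inv (hV₁'' q' hq').1]
  have hes : ∀ q', j q' ∈ V₁ → e.symm (P (j q')) = φ q' := fun q' hq' => by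
    rw [hkey q' hq', e.left_inv (hOsub _ (hV₁'' q' hq').2).1.2]
  have hqV : j q ∈ V₁ := hV₁'.ge ⟨hqs, hqO⟩
  refine ⟨P ⁻¹' (e.target ∩ e.symm ⁻¹' O) ∩ V₁,
    ((e.symm.isOpen_inter_preimage hO).preimage P.continuous).inter hV₁, ⟨⟨?_, ?_⟩, hqV⟩,
    φ.symm ∘ e.symm ∘ P, ?_, fun q' hq' => ?_⟩
  · rw [hkey q hqV]
    exact e.map_source hqe
  · rw [mem_preimage, hes q hqV]
    exact hqO
  · have h1 : ContMDiffOn (𝓡 m) (𝓡 n) ∞ (e.symm ∘ P)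
        (P ⁻¹' (e.target ∩ e.symm ⁻¹' O) ∩ V₁) :=
      contMDiffOn_iff_contDiffOn.2 (hρ.comp P.contDiff.contDiffOn fun z hz => hz.1)
    exact (contMDiffOn_symm_of_mem_maximalAtlas hφ).comp h1 fun z hz => (hOsub _ hz.1.2).1.1
  · simp only [Function.comp_apply]
    rw [hes q' hq'.2, φ.left_inv (hV₁'' q' hq'.2).1]

variable {E : Type*} [NormedAddCommGroup E] [NormedSpace ℝ E]
  {H : Type*} [TopologicalSpace H] {I : ModelWithCorners ℝ E H}
  {M : Type*} [TopologicalSpace M] [ChartedSpace H M]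
  {E' : Type*} [NormedAddCommGroup E'] [NormedSpace ℝ E']
  {H' : Type*} [TopologicalSpace H'] {J : ModelWithCorners ℝ E' H'}
  {X : Type*} [TopologicalSpace X] [ChartedSpace H' X]

/-- Let `σ : M → ℝ^m` have closed image and smooth local lifts `s` defined on open subsets of `ℝ^m`
that cover the image, so that `σ (s z) = z` for `z` in the image. Then a smooth function on `X × M`
that is constant on the fibres of `id × σ` is a pullback along `id × σ`: the functions
`(x, z) ↦ F (x, s z)` are glued by a partition of unity in the variable `z`. -/
theorem exists_smooth_extension_of_local_lifts {m : ℕ} {σ : M → EuclideanSpace ℝ (Fin m)}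
    (hσ : IsClosed (range σ))
    (hs : ∀ p : M, ∃ V : Set (EuclideanSpace ℝ (Fin m)), IsOpen V ∧ σ p ∈ V ∧
      ∃ s : EuclideanSpace ℝ (Fin m) → M, ContMDiffOn (𝓡 m) I ∞ s V ∧
        ∀ p', σ p' ∈ V → σ (s (σ p')) = σ p')
    (F : C^∞⟮J.prod I, X × M; ℝ⟯) (hF : ∀ x p p', σ p = σ p' → F (x, p) = F (x, p')) :
    ∃ G : C^∞⟮J.prod (𝓡 m), X × EuclideanSpace ℝ (Fin m); ℝ⟯, ∀ x p, G (x, σ p) = F (x, p) := by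
  choose V hV hpV s hs hsV using hs
  obtain ⟨χ, hχ⟩ := SmoothPartitionOfUnity.exists_isSubordinate (𝓡 m) hσ V hV
    (by rintro _ ⟨p, rfl⟩; exact mem_iUnion_of_mem p (hpV p))
  have hsmooth : ∀ p, ContMDiff (J.prod (𝓡 m)) 𝓘(ℝ) ∞
      (fun w : X × EuclideanSpace ℝ (Fin m) => χ p w.2 * F (w.1, s p w.2)) := by
    rintro p ⟨x, z⟩
    by_cases hz : z ∈ tsupport (χ p)
    · have hsz : ContMDiffAt (J.prod (𝓡 m)) I ∞
          (fun w : X × EuclideanSpace ℝ (Fin m) => s p w.2) (x, z) :=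
        ((hs p).contMDiffAt ((hV p).mem_nhds (hχ p hz))).comp (x, z) contMDiffAt_snd
      have h1 : ContMDiffAt (J.prod (𝓡 m)) 𝓘(ℝ) ∞
          (fun w : X × EuclideanSpace ℝ (Fin m) => F (w.1, s p w.2)) (x, z) :=
        F.contMDiff.contMDiffAt.comp (x, z) (contMDiffAt_fst.prodMk hsz)
      have h2 : ContMDiffAt (J.prod (𝓡 m)) 𝓘(ℝ) ∞
          (fun w : X × EuclideanSpace ℝ (Fin m) => χ p w.2) (x, z) :=
        (χ p).contMDiff.contMDiffAt.comp (x, z) contMDiffAt_snd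
      exact h2.mul h1
    · refine (contMDiffAt_const (c := (0 : ℝ))).congr_of_eventuallyEq ?_
      filter_upwards [((isClosed_tsupport (χ p)).isOpen_compl.preimage
        continuous_snd).mem_nhds (show (x, z) ∈ _ from hz)] with w hw
      rw [image_eq_zero_of_notMem_tsupport hw, zero_mul]
  refine ⟨⟨fun w => ∑ᶠ p, χ p w.2 * F (w.1, s p w.2), contMDiff_finsum hsmooth
    ((χ.locallyFinite.preimage_continuous continuous_snd).subset fun p w hw =>
      left_ne_zero_of_mul hw)⟩, fun x p => ?_⟩
  have hterm : ∀ p', χ p' (σ p) * F (x, s p' (σ p)) = χ p' (σ p) * F (x, p) := fun p' => by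
    by_cases h : σ p ∈ tsupport (χ p')
    · rw [hF x _ _ (hsV p' p (hχ p' h))]
    · rw [image_eq_zero_of_notMem_tsupport h, zero_mul, zero_mul]
  change ∑ᶠ p', χ p' (σ p) * F (x, s p' (σ p)) = F (x, p)
  rw [finsum_congr hterm, ← finsum_mul, χ.sum_eq_one (mem_range_self p), one_mul]

end Extension

/-! ### Invariants of a free proper cocompact action -/

theorem theoremC (n : ℕ) (Γ : Type*) [Group Γ] (M : Type*) [TopologicalSpace M] [T2Space M]
    [SecondCountableTopology M] [ChartedSpace (EuclideanSpace ℝ (Fin n)) M]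
    [IsManifold (𝓡 n) ∞ M] [MulAction Γ M] [IsSmoothAction n Γ M] [IsCancelSMul Γ M]
    [ProperlyDiscontinuousSMul Γ M] [CompactSpace (MulAction.orbitRel.Quotient Γ M)] :
    (IsFrechetSpace C^∞⟮𝓡 n, MulAction.orbitRel.Quotient Γ M; ℝ⟯ ∧
      IsFrechetSpace (smoothInvariants (𝓡 n) M Γ) ∧
      ∃ Φ : C^∞⟮𝓡 n, MulAction.orbitRel.Quotient Γ M; ℝ⟯ ≃L[ℝ] smoothInvariants (𝓡 n) M Γ,
        ∀ f, (Φ f : C^∞⟮𝓡 n, M; ℝ⟯) = smoothPullback quotientProjection f) ∧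
    ∃ (m : ℕ) (σ : Fin m → C^∞⟮𝓡 n, M; ℝ⟯),
      (∀ i, σ i ∈ smoothInvariants (𝓡 n) M Γ) ∧
      (∃ j : C^∞⟮𝓡 n, MulAction.orbitRel.Quotient Γ M; 𝓡 m, EuclideanSpace ℝ (Fin m)⟯,
        Topology.IsEmbedding j ∧ (∀ q, Function.Injective (mfderiv (𝓡 n) (𝓡 m) j q)) ∧
        smoothTuple σ = j.comp quotientProjection) ∧
      (smoothPullback (smoothTuple σ)).range = smoothInvariants (𝓡 n) M Γ ∧
      ∀ (k : ℕ) (X : Type*) [TopologicalSpace X] [T2Space X] [SecondCountableTopology X]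
        [ChartedSpace (EuclideanSpace ℝ (Fin k)) X] [IsManifold (𝓡 k) ∞ X] [MulAction Γ X],
        (∀ (g : Γ) (x : X), g • x = x) →
        (smoothPullback (ContMDiffMap.prodMk (ContMDiffMap.fst (I := 𝓡 k) (M := X))
          ((smoothTuple σ).comp (ContMDiffMap.snd (I := 𝓡 k) (M := X))))).range =
          smoothInvariants ((𝓡 k).prod (𝓡 n)) (X × M) Γ := by
  have : ContinuousConstSMul Γ M :=
    ⟨fun g => (IsSmoothAction.contMDiff_smul n Γ M g).continuous⟩
  have : LocallyCompactSpace M := ChartedSpace.locallyCompactSpace (EuclideanSpace ℝ (Fin n)) M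
  have hF := isFrechetSpace_smoothFunctions n (MulAction.orbitRel.Quotient Γ M)
  refine ⟨⟨hF, ?_, quotientPullbackContinuousEquiv n Γ M, fun f => rfl⟩, ?_⟩
  · have := (withSeminorms_smoothInvariants n M Γ).topologicalAddGroup
    have := (withSeminorms_smoothInvariants n M Γ).continuousSMul
    exact hF.of_continuousLinearEquiv (quotientPullbackContinuousEquiv n Γ M)
  obtain ⟨m, j₀, hj₀, hjc, hjd⟩ :=
    exists_embedding_euclidean_of_compact (I := 𝓡 n) (M := MulAction.orbitRel.Quotient Γ M)
  obtain ⟨j, rfl⟩ : ∃ j : C^∞⟮𝓡 n, MulAction.orbitRel.Quotient Γ M; 𝓡 m,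
      EuclideanSpace ℝ (Fin m)⟯, ⇑j = j₀ := ⟨⟨j₀, hj₀⟩, rfl⟩
  have hcoord : ∀ i : Fin m, ContMDiff (𝓡 n) 𝓘(ℝ) ∞
      (fun x : M => j (quotientProjection (n := n) (Γ := Γ) x) i) := fun i =>
    (EuclideanSpace.proj (𝕜 := ℝ) i).contDiff.contMDiff.comp
      (j.contMDiff.comp quotientProjection.contMDiff)
  set σ : Fin m → C^∞⟮𝓡 n, M; ℝ⟯ := fun i => ⟨_, hcoord i⟩
  have hσ : ∀ x, smoothTuple σ x = j (quotientProjection (n := n) (Γ := Γ) x) := fun x => rfl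
  have hσg : ∀ (g : Γ) (x : M), smoothTuple σ (g • x) = smoothTuple σ x := fun g x => by
    rw [hσ, hσ, quotientProjection_smul]
  have hσ_eq : ∀ {x y : M}, smoothTuple σ x = smoothTuple σ y → ∃ g : Γ, g • y = x :=
    fun h => (quotientProjection_eq_iff (n := n)).1 (hjc.injective (by rwa [hσ, hσ] at h))
  have hrange : IsClosed (range (smoothTuple σ)) := by
    have : range (smoothTuple σ) = range j := by
      rw [← (quotientProjection_surjective (n := n) (Γ := Γ) (M := M)).range_comp j]
      rfl
    rw [this]
    exact hjc.isClosed_range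
  have hlift : ∀ p : M, ∃ V : Set (EuclideanSpace ℝ (Fin m)), IsOpen V ∧ smoothTuple σ p ∈ V ∧
      ∃ s : EuclideanSpace ℝ (Fin m) → M, ContMDiffOn (𝓡 m) (𝓡 n) ∞ s V ∧
        ∀ p', smoothTuple σ p' ∈ V →
          smoothTuple σ (s (smoothTuple σ p')) = smoothTuple σ p' := by
    intro p
    obtain ⟨V, hV, hpV, r, hr, hrV⟩ := hjc.isEmbedding.exists_smooth_local_leftInverse j.contMDiff
      (hjd (quotientProjection (n := n) (Γ := Γ) p))
    obtain ⟨U, hU, hpU, s, hs, hsU⟩ := exists_smooth_local_section (n := n)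
      (quotientProjection (n := n) (Γ := Γ) p)
    refine ⟨V ∩ r ⁻¹' U, hr.continuousOn.isOpen_inter_preimage hV hU, ⟨hpV, ?_⟩, s ∘ r,
      hs.comp (hr.mono inter_subset_left) fun z hz => hz.2, fun p' hp' => ?_⟩
    · rw [mem_preimage, hσ, hrV _ hpV]
      exact hpU
    · have hr' : r (smoothTuple σ p') = quotientProjection (n := n) (Γ := Γ) p' := hrV _ hp'.1
      rw [hσ, Function.comp_apply, hsU _ hp'.2, hr', hσ]
  refine ⟨m, σ, fun i g x => congrArg (fun z : EuclideanSpace ℝ (Fin m) => z i) (hσg g x),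
    ⟨j, hjc.isEmbedding, hjd, rfl⟩, ?_, ?_⟩
  · refine le_antisymm ?_ fun f hf => ?_
    · rintro _ ⟨G, rfl⟩ g x
      exact congrArg G (hσg g x)
    · -- the parameter manifold is a point
      obtain ⟨G, hG⟩ := exists_smooth_extension_of_local_lifts (J := 𝓡 0)
        (X := EuclideanSpace ℝ (Fin 0)) hrange hlift (f.comp ContMDiffMap.snd)
        fun x p p' hpp' => by
          obtain ⟨g, rfl⟩ := hσ_eq hpp'
          exact hf g p'
      exact ⟨G.comp (ContMDiffMap.prodMk (ContMDiffMap.const 0) ContMDiffMap.id),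
        ContMDiffMap.ext fun x => hG 0 x⟩
  · intro k X _ _ _ _ _ _ hX
    refine le_antisymm ?_ fun f hf => ?_
    · rintro _ ⟨G, rfl⟩ g ⟨x, p⟩
      exact congrArg G (Prod.ext (hX g x) (hσg g p))
    · obtain ⟨G, hG⟩ := exists_smooth_extension_of_local_lifts hrange hlift f
        fun x p p' hpp' => by
          obtain ⟨g, rfl⟩ := hσ_eq hpp'
          have h := hf g (x, p')
          rwa [Prod.smul_mk, hX] at h
      exact ⟨G, ContMDiffMap.ext fun ⟨x, p⟩ => hG x p⟩
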